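/- **Theorem 1.1.** Let $n,k$ be integers with $1\le k\le n-1$. The complete $k$-uniform hypergraph $K_n^{(k)}$ has vertex set $[n]=\{1,\dots,n\}$ and its hyperedges are all $k$-element subsets of $[n]$. A *convex embedding* of a $k$-uniform hypergraph $H=(V,E)$ into $\mathbb{R}^d$ is an injective map $f:V\to\mathbb{R}^d$ such that the set of $k$-barycenters $\left\{\frac1k\sum_{v\in e}f(v) : e\in E\right\}$ is in convex position, i.e. no point of this set is a convex combination of the other points of the set. The *convex dimension* $\mathsf{cd}(H)$ is the minimal $d$ for which a convex embedding of $H$ into $\mathbb{R}^d$ exists. If $2\le k\le n-2$, then $$\mathsf{cd}(K_n^{(k)})=\begin{cases}2k&\text{if } n\ge 2k+2,\\ n-2&\text{if } n\in\{2k-1,2k,2k+1\},\\ 2n-2k&\text{if } n\le 2k-2.\end{cases}$$ Moreover, $\mathsf{cd}(K_2^{(1)})=1$, and $\mathsf{cd}(K_n^{(1)})=\mathsf{cd}(K_n^{(n-1)})=2$ for all $n\ge 3$. -/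

import Mathlib

/-- A `k`-uniform hypergraph on the vertex set `V`: a set of `k`-element subsets of `V`. -/
structure UniformHypergraph (V : Type*) (k : ℕ) where
  /-- The set of hyperedges. -/
  edges : Set (Finset V)
  /-- Every hyperedge has exactly `k` vertices. -/
  card_eq : ∀ e ∈ edges, e.card = k

namespace UniformHypergraph

/-- The complete `k`-uniform hypergraph on `n` vertices. -/
def complete (n k : ℕ) : UniformHypergraph (Fin n) k where
  edges := {e | e.card = k}
  card_eq := fun _ he => he

/-- The set of `k`-barycenters of the hyperedges of `H` under the map `f`. -/
noncomputable def barycenters {V : Type*} {k : ℕ} (H : UniformHypergraph V k) {d : ℕ}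
    (f : V → EuclideanSpace ℝ (Fin d)) : Set (EuclideanSpace ℝ (Fin d)) :=
  {p | ∃ e ∈ H.edges, p = (1 / (k : ℝ)) • ∑ v ∈ e, f v}

/-- A convex embedding of `H` into `ℝ ^ d`: an injective map of the vertices for which the set of
`k`-barycenters of the hyperedges is in convex position. -/
def IsConvexEmbedding {V : Type*} {k : ℕ} (H : UniformHypergraph V k) {d : ℕ}
    (f : V → EuclideanSpace ℝ (Fin d)) : Prop :=
  Function.Injective f ∧ ∀ p ∈ H.barycenters f, p ∉ convexHull ℝ (H.barycenters f \ {p})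

/-- The set of dimensions `d` such that `H` has a convex embedding into `ℝ ^ d`. -/
def embeddingDims {V : Type*} {k : ℕ} (H : UniformHypergraph V k) : Set ℕ :=
  {d | ∃ f : V → EuclideanSpace ℝ (Fin d), H.IsConvexEmbedding f}

/-- The convex dimension of `H`: the least `d` such that `H` has a convex embedding into `ℝ ^ d`,
with value `⊤` if there is no such `d`. -/
noncomputable def cd {V : Type*} {k : ℕ} (H : UniformHypergraph V k) : ℕ∞ :=
  sInf ((fun d : ℕ => (d : ℕ∞)) '' H.embeddingDims)

/-- A finite value of the convex dimension is an attained minimum. -/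
theorem cd_eq_natCast_iff {V : Type*} {k : ℕ} (H : UniformHypergraph V k) (m : ℕ) :
    H.cd = (m : ℕ∞) ↔ IsLeast H.embeddingDims m := by
  unfold cd
  constructor
  · intro h
    have hne : ((fun d : ℕ => (d : ℕ∞)) '' H.embeddingDims).Nonempty := by
      by_contra hc
      rw [Set.not_nonempty_iff_eq_empty] at hc
      rw [hc, sInf_empty] at h
      exact ENat.top_ne_natCast m h
    have hmem := csInf_mem hne
    rw [h] at hmem
    obtain ⟨d, hd, hdm⟩ := hmem
    have hdm' : d = m := Nat.cast_injective (R := ℕ∞) hdm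
    subst hdm'
    refine ⟨hd, fun x hx => ?_⟩
    have hle := sInf_le (Set.mem_image_of_mem (fun d : ℕ => (d : ℕ∞)) hx)
    rw [h] at hle
    exact Nat.cast_le.mp hle
  · rintro ⟨hm, hlb⟩
    apply le_antisymm
    · exact sInf_le (Set.mem_image_of_mem _ hm)
    · apply le_sInf
      rintro _ ⟨x, hx, rfl⟩
      exact Nat.cast_le.mpr (hlb hx)

end UniformHypergraph

open Finset

namespace UniformHypergraph

/-! Lower bounds come from Radon-type dependences: if a nonzero affine dependence has at most `k`
positive and at most `n - k` negative coefficients, some `k`-barycenter is a convex combination of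
barycenters obtained by exchanging one vertex (`not_isConvexEmbedding_of_affineDependence`). A
connectedness argument in the space of dependences finds one whenever `d < 2k`, `d < 2(n - k)` and
`d < n - 2`. Conversely, it suffices to separate every `k`-set of points linearly from its
complement (`isConvexEmbedding_of_separable`). The moment curve does this in dimensions `2k` and
`2(n - k)`, a simplex with its barycenter in dimension `n - 2`; the cases record which bound is
smallest. -/

/-! ### Affine dependences and their sign counts -/

/-- `u` is an affine dependence of the points `f i`. -/
structure IsAffineDependence {V E : Type*} [Fintype V] [AddCommGroup E] [Module ℝ E]
    (f : V → E) (u : V → ℝ) : Prop where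
  sum_eq_zero : ∑ i, u i = 0
  sum_smul_eq_zero : ∑ i, u i • f i = 0

namespace IsAffineDependence

variable {V E : Type*} [Fintype V] [AddCommGroup E] [Module ℝ E] {f : V → E} {u : V → ℝ}

theorem neg (hu : IsAffineDependence f u) : IsAffineDependence f (-u) :=
  ⟨by simp [hu.sum_eq_zero], by simp [hu.sum_smul_eq_zero]⟩

theorem card_pos_pos (hu : IsAffineDependence f u) (h0 : u ≠ 0) :
    0 < #{i | 0 < u i} := by
  by_contra! h
  have h' : ∀ i, u i ≤ 0 := by
    simpa [Finset.filter_eq_empty_iff] using h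
  apply h0
  funext i
  exact (Finset.sum_eq_zero_iff_of_nonpos (fun i _ => h' i)).1 hu.sum_eq_zero i (mem_univ i)

theorem card_neg_pos (hu : IsAffineDependence f u) (h0 : u ≠ 0) :
    0 < #{i | u i < 0} := by
  simpa using hu.neg.card_pos_pos (neg_ne_zero.2 h0)

end IsAffineDependence

/-- The affine dependences of `f` as a linear subspace. -/
def affineDependences {V E : Type*} [Fintype V] [AddCommGroup E] [Module ℝ E]
    (f : V → E) : Submodule ℝ (V → ℝ) where
  carrier := {u | IsAffineDependence f u}
  zero_mem' := ⟨by simp, by simp⟩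
  add_mem' {u v} hu hv := by
    refine ⟨?_, ?_⟩
    · simp [sum_add_distrib, hu.sum_eq_zero, hv.sum_eq_zero]
    · simp [add_smul, sum_add_distrib, hu.sum_smul_eq_zero, hv.sum_smul_eq_zero]
  smul_mem' c u hu := by
    refine ⟨?_, ?_⟩
    · simp [← mul_sum, hu.sum_eq_zero]
    · simp [mul_smul, ← smul_sum, hu.sum_smul_eq_zero]

theorem exists_affineDependence_of_lt {V E : Type*} [Fintype V] [AddCommGroup E] [Module ℝ E]
    [FiniteDimensional ℝ E] (f : V → E) (A : Finset V)
    (h : Module.finrank ℝ E + 1 + #A < Fintype.card V) :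
    ∃ u, IsAffineDependence f u ∧ u ≠ 0 ∧ ∀ i ∈ A, u i = 0 := by
  classical
  let T : (V → ℝ) →ₗ[ℝ] (ℝ × E) × (A → ℝ) :=
    ((∑ i, LinearMap.proj i).prod (∑ i, (LinearMap.proj i).smulRight (f i))).prod
      (LinearMap.pi fun a => LinearMap.proj a.1)
  have hk : LinearMap.ker T ≠ ⊥ := by
    apply LinearMap.ker_ne_bot_of_finrank_lt
    simp
    omega
  obtain ⟨u, hu, h0⟩ := Submodule.exists_mem_ne_zero_of_ne_bot hk
  have hT : T u = 0 := hu
  have h1 := congrArg (fun x => x.1.1) hT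
  have h2 := congrArg (fun x => x.1.2) hT
  have h3 := congrArg (fun x => x.2) hT
  refine ⟨u, ⟨by simpa [T] using h1, by simpa [T] using h2⟩, h0, fun i hi => ?_⟩
  simpa [T] using congrFun h3 ⟨i, hi⟩

theorem card_pos_add_card_neg_le {V : Type*} [Fintype V] {u : V → ℝ} {A : Finset V}
    (h : ∀ i ∈ A, u i = 0) :
    #{i | 0 < u i} + #{i | u i < 0} + #A ≤ Fintype.card V := by
  classical
  rw [← card_union_of_disjoint, ← card_union_of_disjoint]
  · exact card_le_univ _
  · rw [disjoint_left]
    intro i hi hA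
    simp [h i hA] at hi
  · rw [disjoint_left]
    intro i hi hj
    simp only [mem_filter, mem_univ, true_and] at hi hj
    exact lt_asymm hi hj

/-- Forcing all but `finrank + 2` coefficients to vanish still leaves one more unknown than
equations. -/
theorem exists_affineDependence_card_le {V E : Type*} [Fintype V] [AddCommGroup E] [Module ℝ E]
    [FiniteDimensional ℝ E] (f : V → E) (h : Module.finrank ℝ E + 2 ≤ Fintype.card V) :
    ∃ u, IsAffineDependence f u ∧ u ≠ 0 ∧
      #{i | 0 < u i} + #{i | u i < 0} ≤ Module.finrank ℝ E + 2 := by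
  obtain ⟨A, -, hA⟩ := exists_subset_card_eq (s := (univ : Finset V))
    (n := Fintype.card V - (Module.finrank ℝ E + 2)) (by simp)
  obtain ⟨u, hu, h0, hz⟩ := exists_affineDependence_of_lt f A (by omega)
  have := card_pos_add_card_neg_le hz
  exact ⟨u, hu, h0, by omega⟩

/-- Rank above one is what keeps the space connected once the origin is removed. -/
theorem one_lt_rank_affineDependences {V E : Type*} [Fintype V] [AddCommGroup E] [Module ℝ E]
    [FiniteDimensional ℝ E] (f : V → E) (h : Module.finrank ℝ E + 3 ≤ Fintype.card V) :
    1 < Module.rank ℝ (affineDependences f) := by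
  let T : (V → ℝ) →ₗ[ℝ] ℝ × E :=
    (∑ i, LinearMap.proj i).prod (∑ i, (LinearMap.proj i).smulRight (f i))
  have hle : LinearMap.ker T ≤ affineDependences f := by
    intro u hu
    have hT : T u = 0 := hu
    have h1 := congrArg Prod.fst hT
    have h2 := congrArg Prod.snd hT
    exact ⟨by simpa [T] using h1, by simpa [T] using h2⟩
  have h1 := T.finrank_range_add_finrank_ker
  have h2 := Submodule.finrank_le (LinearMap.range T)
  have h3 := Submodule.finrank_mono hle
  simp at h1 h2
  rw [← Module.finrank_eq_rank]
  exact_mod_cast (show 1 < Module.finrank ℝ (affineDependences f) by omega)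

theorem isOpen_le_card_filter_pos {X V : Type*} [TopologicalSpace X] [Fintype V]
    {g : V → X → ℝ} (hg : ∀ i, Continuous (g i)) (m : ℕ) :
    IsOpen {x | m ≤ #{i | 0 < g i x}} := by
  have : {x | m ≤ #{i | 0 < g i x}} =
      ⋃ A ∈ {A : Finset V | m ≤ #A}, ⋂ i ∈ A, {x | 0 < g i x} := by
    ext x
    simp only [Set.mem_ofPred_eq, Set.mem_iUnion, Set.mem_iInter, exists_prop]
    constructor
    · intro h
      exact ⟨_, h, fun i hi => by simpa using hi⟩
    · rintro ⟨A, hA, hx⟩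
      exact hA.trans (card_le_card fun i hi => by simpa using hx i hi)
  rw [this]
  refine isOpen_biUnion fun A _ => isOpen_biInter_finset fun i _ => ?_
  exact isOpen_lt continuous_const (hg i)

/-! ### Lower bounds on the dimension -/

/-- A linear version of the hypersimplicial van Kampen–Flores theorem: a large point
configuration has an affine dependence with bounds on the number of positive and of negative
coefficients. -/
theorem exists_affineDependence_card_pos_le_card_neg_le {V E : Type*} [Fintype V]
    [AddCommGroup E] [Module ℝ E] [FiniteDimensional ℝ E] (f : V → E) {k l : ℕ}
    (hkl : Fintype.card V ≤ k + l) (h : Module.finrank ℝ E + 3 ≤ Fintype.card V)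
    (hk : Module.finrank ℝ E < 2 * k) (hl : Module.finrank ℝ E < 2 * l) :
    ∃ u, IsAffineDependence f u ∧ u ≠ 0 ∧ #{i | 0 < u i} ≤ k ∧ #{i | u i < 0} ≤ l := by
  by_contra! hc
  have hconn := (isConnected_compl_singleton_of_one_lt_rank (one_lt_rank_affineDependences f h)
    0).isPreconnected
  obtain ⟨v, hv, hv0, hcard⟩ := exists_affineDependence_card_le f (by omega)
  have hcont : ∀ i, Continuous fun x : affineDependences f => x.1 i := fun i =>
    (continuous_apply i).comp continuous_subtype_val
  have hP := isOpen_le_card_filter_pos hcont (k + 1)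
  have hN : IsOpen {x : affineDependences f | l + 1 ≤ #{i | x.1 i < 0}} := by
    simpa using isOpen_le_card_filter_pos (fun i => (hcont i).neg) (l + 1)
  -- If the claim fails, two open sets cover the punctured space; they are disjoint because the sign
  -- counts add up to at most `k + l`. By connectedness one of them is everything.
  have hcover : ({0}ᶜ : Set (affineDependences f)) ⊆
      {x | k + 1 ≤ #{i | 0 < x.1 i}} ∪ {x | l + 1 ≤ #{i | x.1 i < 0}} := by
    intro x hx
    by_cases hxk : #{i | 0 < x.1 i} ≤ k
    · exact Or.inr (hc x.1 x.2 (fun h => hx (Subtype.ext h)) hxk)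
    · exact Or.inl (by simpa using hxk)
  have hdisj : ({0}ᶜ : Set (affineDependences f)) ∩
      ({x | k + 1 ≤ #{i | 0 < x.1 i}} ∩ {x | l + 1 ≤ #{i | x.1 i < 0}}) = ∅ := by
    ext x
    simp only [Set.mem_inter_iff, Set.mem_ofPred_eq, Set.mem_empty_iff_false, iff_false]
    rintro ⟨-, h1, h2⟩
    have := card_pos_add_card_neg_le (u := x.1) (A := ∅) (by simp)
    simp only [card_empty] at this
    omega
  have hmem : (⟨v, hv⟩ : affineDependences f) ∈ ({0}ᶜ : Set (affineDependences f)) :=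
    fun h => hv0 (congrArg Subtype.val h)
  have hmem' : (⟨-v, hv.neg⟩ : affineDependences f) ∈ ({0}ᶜ : Set (affineDependences f)) :=
    fun h => neg_ne_zero.2 hv0 (congrArg Subtype.val h)
  -- Both `v` and `-v` lie in that set, so `v` has too many nonzero coefficients for its small
  -- support.
  rcases isPreconnected_iff_subset_of_disjoint.1 hconn _ _ hP hN hcover hdisj with hs | hs
  · have h1 := hs hmem
    have h2 := hs hmem'
    simp only [Set.mem_ofPred_eq, Pi.neg_apply, Left.neg_pos_iff] at h1 h2
    omega
  · have h1 := hs hmem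
    have h2 := hs hmem'
    simp only [Set.mem_ofPred_eq, Pi.neg_apply, Left.neg_neg_iff] at h1 h2
    omega

/-- A Radon pair that fits into a `k`-set and its complement obstructs convex embeddings. -/
theorem not_isConvexEmbedding_of_affineDependence {n k d : ℕ} (hkn : k ≤ n)
    {f : Fin n → EuclideanSpace ℝ (Fin d)} {u : Fin n → ℝ} (hu : IsAffineDependence f u)
    (h0 : u ≠ 0) (hp : #{i | 0 < u i} ≤ k) (hn : #{i | u i < 0} ≤ n - k) :
    ¬ (complete n k).IsConvexEmbedding f := by
  rintro ⟨hinj, hconv⟩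
  have hcompl : k ≤ #({i | u i < 0} : Finset (Fin n))ᶜ := by
    rw [card_compl, Fintype.card_fin]
    omega
  obtain ⟨S, hS1, hS2, hSk⟩ := exists_subsuperset_card_eq
    (s := ({i | 0 < u i} : Finset (Fin n))) (t := ({i | u i < 0} : Finset (Fin n))ᶜ)
    (fun i hi => by
      simp only [mem_compl, mem_filter, mem_univ, true_and, not_lt] at hi ⊢
      exact hi.le) hp hcompl
  have hin : ∀ i ∈ S, 0 ≤ u i := fun i hi => by simpa using hS2 hi
  have hout : ∀ i ∈ Sᶜ, 0 ≤ -u i := fun i hi => by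
    rw [mem_compl] at hi
    have : ¬ 0 < u i := fun h => hi (hS1 (by simpa using h))
    linarith
  have hsplit := sum_add_sum_compl S u
  have hsplit' := sum_add_sum_compl S fun i => u i • f i
  rw [hu.sum_eq_zero] at hsplit
  rw [hu.sum_smul_eq_zero] at hsplit'
  set a := ∑ i ∈ S, u i with ha
  have hneg : ∑ i ∈ Sᶜ, -u i = a := by
    rw [sum_neg_distrib]
    linarith
  have hneg' : ∑ i ∈ Sᶜ, (-u i) • f i = ∑ i ∈ S, u i • f i := by
    simp only [neg_smul, sum_neg_distrib]
    exact (eq_neg_of_add_eq_zero_left hsplit').symm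
  have hapos : 0 < a := by
    obtain ⟨i, hi⟩ := card_pos.1 (hu.card_pos_pos h0)
    have hi' : 0 < u i := by simpa using hi
    exact hi'.trans_le (single_le_sum hin (hS1 hi))
  have hSmem : S ∈ (complete n k).edges := hSk
  set p := (1 / (k : ℝ)) • ∑ v ∈ S, f v with hpdef
  refine hconv p ⟨S, hSmem, rfl⟩ ?_
  -- Exchange `i ∈ S` for `j ∉ S` with product weights: the average displacement is the difference
  -- of the two Radon points, hence zero.
  have hcomb : ∑ x ∈ S ×ˢ Sᶜ, (u x.1 * -u x.2 / (a * a)) •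
      (p + (1 / (k : ℝ)) • (f x.2 - f x.1)) = p := by
    have hw : ∑ i ∈ S, ∑ j ∈ Sᶜ, (u i * -u j) = a * a := by
      simp_rw [← mul_sum]
      rw [hneg, ← sum_mul]
    have hf : ∑ i ∈ S, ∑ j ∈ Sᶜ, (u i * -u j) • (f j - f i) = 0 := by
      simp_rw [smul_sub, sum_sub_distrib]
      have e1 : ∑ i ∈ S, ∑ j ∈ Sᶜ, (u i * -u j) • f j = a • ∑ i ∈ S, u i • f i := by
        simp_rw [mul_smul, ← smul_sum]
        rw [hneg', ← sum_smul]
      have e2 : ∑ i ∈ S, ∑ j ∈ Sᶜ, (u i * -u j) • f i = a • ∑ i ∈ S, u i • f i := by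
        simp_rw [← sum_smul, ← mul_sum, hneg, smul_sum, smul_smul, mul_comm]
      rw [e1, e2, sub_self]
    rw [sum_product]
    have hterm : ∀ i j, (u i * -u j / (a * a)) • (p + (1 / (k : ℝ)) • (f j - f i)) =
        (a * a)⁻¹ • ((u i * -u j) • p + (1 / (k : ℝ)) • ((u i * -u j) • (f j - f i))) := by
      intro i j
      module
    simp_rw [hterm, ← smul_sum, sum_add_distrib, ← smul_sum, hf, ← sum_smul, hw]
    rw [smul_zero, add_zero, smul_smul, inv_mul_cancel₀ (by positivity), one_smul]
  refine Set.mem_of_eq_of_mem hcomb.symm ((convex_convexHull ℝ _).sum_mem ?_ ?_ ?_)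
  · rintro ⟨i, j⟩ hij
    rw [mem_product] at hij
    exact div_nonneg (mul_nonneg (hin _ hij.1) (hout _ hij.2)) (by positivity)
  · rw [← sum_div, sum_product]
    simp_rw [← mul_sum]
    rw [hneg, ← sum_mul]
    exact div_self (by positivity)
  · rintro ⟨i, j⟩ hij
    rw [mem_product, mem_compl] at hij
    obtain ⟨hi, hj⟩ := hij
    apply subset_convexHull
    have hk0 : (k : ℝ) ≠ 0 := by
      have : 0 < #S := card_pos.2 ⟨i, hi⟩
      exact_mod_cast (by omega : k ≠ 0)
    have hji : j ∉ S.erase i := fun h => hj (mem_of_mem_erase h)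
    have hij : i ≠ j := fun h => hj (h ▸ hi)
    refine ⟨⟨insert j (S.erase i), ?_, ?_⟩, ?_⟩
    · change #(insert j (S.erase i)) = k
      rw [card_insert_of_notMem hji, card_erase_add_one hi, hSk]
    · rw [hpdef, ← smul_add, sum_insert hji, ← add_sum_erase S f hi]
      congr 1
      abel
    · simp only [Set.mem_singleton_iff, add_eq_left, smul_eq_zero, not_or]
      exact ⟨by positivity, sub_ne_zero.2 fun h => hij (hinj h).symm⟩

theorem not_isConvexEmbedding_of_lt {n k d : ℕ} (hkn : k ≤ n) (hd : d + 3 ≤ n)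
    (hk : d < 2 * k) (hl : d < 2 * (n - k)) (f : Fin n → EuclideanSpace ℝ (Fin d)) :
    ¬ (complete n k).IsConvexEmbedding f := by
  obtain ⟨u, hu, h0, h1, h2⟩ := exists_affineDependence_card_pos_le_card_neg_le f (k := k)
    (l := n - k) (by simp; omega) (by simpa using hd) (by simpa using hk) (by simpa using hl)
  exact not_isConvexEmbedding_of_affineDependence hkn hu h0 h1 h2

theorem not_isConvexEmbedding_dim_zero {n k : ℕ} (hn : 2 ≤ n)
    (f : Fin n → EuclideanSpace ℝ (Fin 0)) : ¬ (complete n k).IsConvexEmbedding f := by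
  intro h
  have := @h.1 ⟨0, by omega⟩ ⟨1, by omega⟩ (Subsingleton.elim _ _)
  simp at this

/-- A dependence on at most three points has a sign class of size one and another of size at most
two; negating it if necessary makes it fit, which also covers `n = 3`. -/
theorem not_isConvexEmbedding_dim_one {n k : ℕ} (hn : 3 ≤ n) (hk : k = 1 ∨ k = n - 1)
    (f : Fin n → EuclideanSpace ℝ (Fin 1)) : ¬ (complete n k).IsConvexEmbedding f := by
  obtain ⟨u, hu, h0, hcard⟩ := exists_affineDependence_card_le f (by simpa using hn)
  rw [finrank_euclideanSpace_fin] at hcard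
  have h1 := hu.card_pos_pos h0
  have h2 := hu.card_neg_pos h0
  have key : (#{i | 0 < u i} ≤ k ∧ #{i | u i < 0} ≤ n - k) ∨
      (#{i | u i < 0} ≤ k ∧ #{i | 0 < u i} ≤ n - k) := by omega
  rcases key with ⟨h3, h4⟩ | ⟨h3, h4⟩
  · exact not_isConvexEmbedding_of_affineDependence (by omega) hu h0 h3 h4
  · exact not_isConvexEmbedding_of_affineDependence (by omega) hu.neg (neg_ne_zero.2 h0)
      (by simpa using h3) (by simpa using h4)

/-! ### Separability and constructions -/

/-- If every `k`-set of points is linearly separable from its complement, the map is a convex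
embedding of the complete `k`-uniform hypergraph. -/
theorem isConvexEmbedding_of_separable {n k d : ℕ} (hk : 1 ≤ k) (hkn : k < n)
    {f : Fin n → EuclideanSpace ℝ (Fin d)}
    (h : ∀ S : Finset (Fin n), #S = k → ∃ φ : EuclideanSpace ℝ (Fin d) →ₗ[ℝ] ℝ,
      ∀ i ∈ S, ∀ j ∉ S, φ (f j) < φ (f i)) :
    (complete n k).IsConvexEmbedding f := by
  constructor
  · intro i j hij
    by_contra hne
    obtain ⟨S, hS1, hS2, hS⟩ := exists_subsuperset_card_eq (s := {i}) (t := univ.erase j) (n := k)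
      (by simpa using hne) (by simpa using hk) (by simp; omega)
    obtain ⟨φ, hφ⟩ := h S hS
    have := hφ i (hS1 (by simp)) j (fun hj => by simpa using hS2 hj)
    rw [hij] at this
    exact lt_irrefl _ this
  · rintro p ⟨S, hS, rfl⟩ hmem
    change #S = k at hS
    obtain ⟨φ, hφ⟩ := h S hS
    have hsub : (complete n k).barycenters f \ {(1 / (k : ℝ)) • ∑ v ∈ S, f v} ⊆
        {x | φ x < φ ((1 / (k : ℝ)) • ∑ v ∈ S, f v)} := by
      rintro _ ⟨⟨T, hT, rfl⟩, hne⟩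
      change #T = k at hT
      have hTS : T ≠ S := fun h => hne (by simp [h])
      have hkpos : (0 : ℝ) < 1 / k := by positivity
      simp only [Set.mem_ofPred_eq, map_smul, smul_eq_mul, map_sum]
      refine mul_lt_mul_of_pos_left ?_ hkpos
      -- Cancel `S ∩ T`; the remaining differences have equal size, and the minimum of `φ` over `S`
      -- separates them termwise.
      rw [← sum_sdiff_lt_sum_sdiff]
      obtain ⟨i₀, hi₀, hmin⟩ := exists_min_image S (fun i => φ (f i)) (card_pos.1 (by omega))
      have hcard : #(T \ S) = #(S \ T) := card_sdiff_comm (hT.trans hS.symm)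
      have hTS' : (T \ S).Nonempty := by
        rw [sdiff_nonempty]
        exact fun hsub => hTS (eq_of_subset_of_card_le hsub (by omega))
      calc ∑ j ∈ T \ S, φ (f j) < ∑ _j ∈ T \ S, φ (f i₀) :=
            sum_lt_sum_of_nonempty hTS' fun j hj => hφ i₀ hi₀ j (mem_sdiff.1 hj).2
        _ = ∑ _i ∈ S \ T, φ (f i₀) := by simp [hcard]
        _ ≤ ∑ i ∈ S \ T, φ (f i) := sum_le_sum fun i hi => hmin i (mem_sdiff.1 hi).1
    exact lt_irrefl _ (Set.mem_ofPred_eq ▸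
      convexHull_min hsub (convex_halfSpace_lt φ.isLinear _) hmem)

/-- Integer points on the moment curve. -/
noncomputable def momentCurve (n d : ℕ) (i : Fin n) : EuclideanSpace ℝ (Fin d) :=
  WithLp.toLp 2 fun j => ((i : ℕ) : ℝ) ^ ((j : ℕ) + 1)

open Polynomial in
theorem exists_linearMap_momentCurve {n d : ℕ} {p : ℝ[X]} (hp : p.natDegree ≤ d) :
    ∃ φ : EuclideanSpace ℝ (Fin d) →ₗ[ℝ] ℝ, ∀ i : Fin n,
      φ (momentCurve n d i) = p.eval ((i : ℕ) : ℝ) - p.coeff 0 := by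
  refine ⟨∑ j : Fin d, p.coeff (j + 1) • (EuclideanSpace.proj j).toLinearMap, fun i => ?_⟩
  rw [eval_eq_sum_range' (Nat.lt_succ_of_le hp), sum_range_succ']
  simp [momentCurve, Finset.sum_range]

open Polynomial in
-- The product has double zeros exactly at `A`, so it separates `A` from the other points; its
-- constant term is absorbed in `c`.
theorem exists_linearMap_momentCurve_eq_prod {n d : ℕ} (A : Finset (Fin n)) (hA : 2 * #A = d) :
    ∃ (φ : EuclideanSpace ℝ (Fin d) →ₗ[ℝ] ℝ) (c : ℝ), ∀ i : Fin n,
      φ (momentCurve n d i) = ∏ a ∈ A, (((i : ℕ) : ℝ) - ((a : ℕ) : ℝ)) ^ 2 - c := by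
  obtain ⟨φ, hφ⟩ := exists_linearMap_momentCurve (n := n) (d := d)
    (p := ∏ a ∈ A, (X - C ((a : ℕ) : ℝ)) ^ 2) (by
      refine (natDegree_prod_le _ _).trans ?_
      simp only [natDegree_pow, natDegree_X_sub_C, sum_const, smul_eq_mul]
      omega)
  refine ⟨φ, (∏ a ∈ A, (X - C ((a : ℕ) : ℝ)) ^ 2).coeff 0, fun i => ?_⟩
  rw [hφ, eval_prod]
  simp only [eval_pow, eval_sub, eval_X, eval_C]

theorem prod_sq_sub_eq_zero {n : ℕ} {A : Finset (Fin n)} {i : Fin n} (hi : i ∈ A) :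
    ∏ a ∈ A, (((i : ℕ) : ℝ) - ((a : ℕ) : ℝ)) ^ 2 = 0 :=
  prod_eq_zero hi (by simp)

theorem prod_sq_sub_pos {n : ℕ} {A : Finset (Fin n)} {i : Fin n} (hi : i ∉ A) :
    0 < ∏ a ∈ A, (((i : ℕ) : ℝ) - ((a : ℕ) : ℝ)) ^ 2 := by
  refine prod_pos fun a ha => ?_
  have hne : ((i : ℕ) : ℝ) - ((a : ℕ) : ℝ) ≠ 0 := by
    rw [sub_ne_zero]
    exact fun h => hi (Fin.ext (Nat.cast_injective h) ▸ ha)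
  positivity

theorem two_mul_mem_embeddingDims {n k : ℕ} (hk : 1 ≤ k) (hkn : k < n) :
    2 * k ∈ (complete n k).embeddingDims := by
  refine ⟨momentCurve n (2 * k), isConvexEmbedding_of_separable hk hkn fun S hS => ?_⟩
  obtain ⟨φ, c, hφ⟩ := exists_linearMap_momentCurve_eq_prod (d := 2 * k) S (by rw [hS])
  refine ⟨-φ, fun i hi j hj => ?_⟩
  have := prod_sq_sub_pos hj
  rw [LinearMap.neg_apply, LinearMap.neg_apply, hφ, hφ, prod_sq_sub_eq_zero hi]
  linarith

theorem two_mul_sub_mem_embeddingDims {n k : ℕ} (hk : 1 ≤ k) (hkn : k < n) :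
    2 * (n - k) ∈ (complete n k).embeddingDims := by
  refine ⟨momentCurve n (2 * (n - k)), isConvexEmbedding_of_separable hk hkn fun S hS => ?_⟩
  obtain ⟨φ, c, hφ⟩ := exists_linearMap_momentCurve_eq_prod (d := 2 * (n - k)) Sᶜ
    (by rw [card_compl, hS, Fintype.card_fin])
  refine ⟨φ, fun i hi j hj => ?_⟩
  have := prod_sq_sub_pos (A := Sᶜ) (i := i) (by simpa using hi)
  rw [hφ, hφ, prod_sq_sub_eq_zero (A := Sᶜ) (i := j) (by simpa using hj)]
  linarith

/-- The vertices of a simplex followed by its barycenter. -/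
noncomputable def coneSimplex (m : ℕ) : Fin (m + 2) → EuclideanSpace ℝ (Fin m) :=
  Fin.snoc (α := fun _ => EuclideanSpace ℝ (Fin m))
    (Fin.cons (α := fun _ => EuclideanSpace ℝ (Fin m)) 0 fun i => EuclideanSpace.single i 1)
    (WithLp.toLp 2 fun _ => 1 / ((m : ℝ) + 1))

theorem exists_linearMap_coneSimplex {m : ℕ} (a : Fin (m + 1) → ℝ) :
    ∃ (φ : EuclideanSpace ℝ (Fin m) →ₗ[ℝ] ℝ) (c : ℝ),
      (∀ i, φ (coneSimplex m (Fin.castSucc i)) = a i - c) ∧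
        φ (coneSimplex m (Fin.last _)) = (∑ i, a i) / (m + 1) - c := by
  refine ⟨∑ j : Fin m, (a j.succ - a 0) • (EuclideanSpace.proj j).toLinearMap, a 0,
    fun i => ?_, ?_⟩
  · refine Fin.cases ?_ (fun i => ?_) i
    · rw [coneSimplex, Fin.snoc_castSucc]
      simp
    · rw [coneSimplex, Fin.snoc_castSucc]
      simp
  · rw [coneSimplex, Fin.snoc_last, Fin.sum_univ_succ]
    have : (m : ℝ) + 1 ≠ 0 := by positivity
    simp [← sum_mul]
    field_simp
    ring

theorem sub_two_mem_embeddingDims {n k : ℕ} (hk : 2 ≤ k) (hkn : k + 2 ≤ n) :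
    n - 2 ∈ (complete n k).embeddingDims := by
  obtain ⟨m, rfl⟩ : ∃ m, n = m + 2 := ⟨n - 2, by omega⟩
  refine ⟨coneSimplex m, isConvexEmbedding_of_separable (by omega) (by omega) fun S hS => ?_⟩
  -- Prescribe the indicator of `S` on the simplex vertices. The barycenter then gets `(k - 1) / (m
  -- + 1) > 0` if it lies in `S`, and `k / (m + 1) < 1` otherwise.
  obtain ⟨φ, c, hφ, hφ'⟩ := exists_linearMap_coneSimplex
    fun i : Fin (m + 1) => if i.castSucc ∈ S then (1 : ℝ) else 0
  have hsum : (∑ i : Fin (m + 1), if i.castSucc ∈ S then (1 : ℝ) else 0) +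
      (if Fin.last (m + 1) ∈ S then (1 : ℝ) else 0) = k := by
    rw [← Fin.sum_univ_castSucc fun i : Fin (m + 2) => if i ∈ S then (1 : ℝ) else 0]
    simp [hS]
  have hm : (0 : ℝ) < m + 1 := by positivity
  have hk2 : (2 : ℝ) ≤ k := by exact_mod_cast hk
  have hkm : (k : ℝ) ≤ m := by exact_mod_cast (by omega : k ≤ m)
  refine ⟨φ, fun i hi j hj => ?_⟩
  induction i using Fin.lastCases with
  | last =>
    induction j using Fin.lastCases with
    | last => exact absurd hi hj
    | cast j =>
      rw [hφ, hφ', if_neg hj]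
      rw [if_pos hi] at hsum
      have := div_pos (show (0 : ℝ) < ∑ i : Fin (m + 1), if i.castSucc ∈ S then (1 : ℝ) else 0
        by linarith) hm
      linarith
  | cast i =>
    induction j using Fin.lastCases with
    | last =>
      rw [hφ, hφ', if_pos hi]
      rw [if_neg hj] at hsum
      have := (div_lt_one hm).2 (show (∑ i : Fin (m + 1), if i.castSucc ∈ S then (1 : ℝ) else 0)
        < m + 1 by linarith)
      linarith
    | cast j =>
      rw [hφ, hφ, if_pos hi, if_neg hj]
      linarith

theorem one_mem_embeddingDims_complete_two_one : 1 ∈ (complete 2 1).embeddingDims := by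
  refine ⟨momentCurve 2 1, isConvexEmbedding_of_separable le_rfl (by omega) fun S hS => ?_⟩
  obtain ⟨φ, hφ⟩ := exists_linearMap_momentCurve (n := 2) (d := 1) (p := Polynomial.X)
    Polynomial.natDegree_X_le
  obtain ⟨a, rfl⟩ := card_eq_one.1 hS
  fin_cases a
  · refine ⟨-φ, fun i hi j hj => ?_⟩
    fin_cases i <;> fin_cases j <;> simp_all
  · refine ⟨φ, fun i hi j hj => ?_⟩
    fin_cases i <;> fin_cases j <;> simp_all

/-! ### Exact values -/

theorem cd_complete_eq {n k m : ℕ} (hm : m ∈ (complete n k).embeddingDims)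
    (h : ∀ d < m, ∀ f : Fin n → EuclideanSpace ℝ (Fin d), ¬ (complete n k).IsConvexEmbedding f) :
    (complete n k).cd = m := by
  rw [cd_eq_natCast_iff]
  refine ⟨hm, fun d ⟨f, hf⟩ => ?_⟩
  by_contra! hd
  exact h d hd f hf

theorem cd_complete_eq_two {n k : ℕ} (hn : 3 ≤ n) (hk : k = 1 ∨ k = n - 1) :
    (complete n k).cd = 2 := by
  refine cd_complete_eq (m := 2) ?_ fun d hd f => ?_
  · rcases hk with rfl | rfl
    · exact two_mul_mem_embeddingDims le_rfl (by omega)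
    · have := two_mul_sub_mem_embeddingDims (n := n) (k := n - 1) (by omega) (by omega)
      rwa [show 2 * (n - (n - 1)) = 2 by omega] at this
  · interval_cases d
    · exact not_isConvexEmbedding_dim_zero (by omega) f
    · exact not_isConvexEmbedding_dim_one hn hk f

end UniformHypergraph

open UniformHypergraph

theorem theorem1p1 :
    (∀ n k : ℕ, 2 ≤ k → k + 2 ≤ n →
      (2 * k + 2 ≤ n → (UniformHypergraph.complete n k).cd = ((2 * k : ℕ) : ℕ∞)) ∧
      (n = 2 * k - 1 ∨ n = 2 * k ∨ n = 2 * k + 1 →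
        (UniformHypergraph.complete n k).cd = ((n - 2 : ℕ) : ℕ∞)) ∧
      (n ≤ 2 * k - 2 → (UniformHypergraph.complete n k).cd = ((2 * n - 2 * k : ℕ) : ℕ∞))) ∧
    (UniformHypergraph.complete 2 1).cd = 1 ∧
    (∀ n : ℕ, 3 ≤ n →
      (UniformHypergraph.complete n 1).cd = 2 ∧
      (UniformHypergraph.complete n (n - 1)).cd = 2) := by
  refine ⟨fun n k hk hkn => ⟨fun h => ?_, fun h => ?_, fun h => ?_⟩, ?_, fun n hn => ⟨?_, ?_⟩⟩
  · exact cd_complete_eq (two_mul_mem_embeddingDims (by omega) (by omega)) fun d hd f =>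
      not_isConvexEmbedding_of_lt (by omega) (by omega) (by omega) (by omega) f
  · exact cd_complete_eq (sub_two_mem_embeddingDims hk hkn) fun d hd f =>
      not_isConvexEmbedding_of_lt (by omega) (by omega) (by omega) (by omega) f
  · rw [← Nat.mul_sub]
    exact cd_complete_eq (two_mul_sub_mem_embeddingDims (by omega) (by omega)) fun d hd f =>
      not_isConvexEmbedding_of_lt (by omega) (by omega) (by omega) (by omega) f
  · refine cd_complete_eq (m := 1) one_mem_embeddingDims_complete_two_one fun d hd f => ?_
    interval_cases d
    exact not_isConvexEmbedding_dim_zero le_rfl f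
  · exact cd_complete_eq_two hn (Or.inl rfl)
  · exact cd_complete_eq_two hn (Or.inr rfl)
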